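/- Let $(\mathcal X,\mathcal F,\mu)$ and $(\mathcal Y,\mathcal G,\nu)$ be arbitrary probability spaces. For a probability measure $Q$, let $L_1(Q)$ be the class of measurable and $Q$-integrable real functions (functions agreeing $Q$-a.s. are not identified). Let $\Gamma(\mu,\nu)$ be the set of probability measures $P$ on $\mathcal F\otimes\mathcal G$ with marginals $\mu$ and $\nu$, that is, $P(A\times\mathcal Y)=\mu(A)$ for all $A\in\mathcal F$ and $P(\mathcal X\times B)=\nu(B)$ for all $B\in\mathcal G$. Let $c:\mathcal X\times\mathcal Y\to\mathbb R$ be $\mathcal F\otimes\mathcal G$-measurable and suppose that there are $f_1,f_2\in L_1(\mu)$ and $g_1,g_2\in L_1(\nu)$ such that $f_1(x)+g_1(y)\le c(x,y)\le f_2(x)+g_2(y)$ for all $(x,y)\in\mathcal X\times\mathcal Y$. Define $$\alpha(c)=\inf_{P\in\Gamma(\mu,\nu)}\int c\,dP,\qquad \alpha^*(c)=\sup_{P\in\Gamma(\mu,\nu)}\int c\,dP,$$ $$\beta(c)=\sup\Bigl\{\int f\,d\mu+\int g\,d\nu:\ f\in L_1(\mu),\ g\in L_1(\nu),\ f(x)+g(y)\le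 c(x,y)\text{ for all }(x,y)\Bigr\},$$ $$\beta^*(c)=\inf\Bigl\{\int f\,d\mu+\int g\,d\nu:\ f\in L_1(\mu),\ g\in L_1(\nu),\ f(x)+g(y)\ge c(x,y)\text{ for all }(x,y)\Bigr\}.$$ Suppose that at least one of the following two conditions holds. (*) For each $\epsilon>0$ there is a countable partition $\{A_0,A_1,\ldots\}\subset\mathcal F$ of $\mathcal X$ (members may be empty) such that $\mu(A_0)=0$ and $\sup_{y\in\mathcal Y}|c(x,y)-c(z,y)|\le\epsilon$ whenever $x,z\in A_i$ and $i>0$. (**) For each $\epsilon>0$ there is a countable partition $\{B_0,B_1,\ldots\}\subset\mathcal G$ of $\mathcal Y$ (members may be empty) such that $\nu(B_0)=0$ and $\sup_{x\in\mathcal X}|c(x,y)-c(x,z)|\le\epsilon$ whenever $y,z\in B_i$ and $i>0$. Then $\alpha(c)=\beta(c)$ and $\alpha^*(c)=\beta^*(c)$. -/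

import Mathlib

open MeasureTheory

noncomputable section

namespace MassTransport

variable {X Y : Type*} [MeasurableSpace X] [MeasurableSpace Y]

/-- `L₁(Q)`: the real functions that are measurable and `Q`-integrable, without identifying
functions that agree almost surely. -/
def L1 {Ω : Type*} [MeasurableSpace Ω] (Q : Measure Ω) : Set (Ω → ℝ) :=
  {φ | Measurable φ ∧ Integrable φ Q}

/-- `Γ(μ, ν)`: the probability measures on the product σ-field with marginals `μ` and `ν`. -/
def couplings (μ : Measure X) (ν : Measure Y) : Set (Measure (X × Y)) :=
  {P | IsProbabilityMeasure P ∧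
    (∀ A : Set X, MeasurableSet A → P (A ×ˢ Set.univ) = μ A) ∧
    (∀ B : Set Y, MeasurableSet B → P (Set.univ ×ˢ B) = ν B)}

/-- `M`: the product-measurable functions `c` with `f₁ + g₁ ≤ c ≤ f₂ + g₂` everywhere, for some
`f₁, f₂ ∈ L₁(μ)` and `g₁, g₂ ∈ L₁(ν)`. -/
def costs (μ : Measure X) (ν : Measure Y) : Set (X × Y → ℝ) :=
  {c | Measurable c ∧
    (∃ f₁ ∈ L1 μ, ∃ g₁ ∈ L1 ν, ∀ x y, f₁ x + g₁ y ≤ c (x, y)) ∧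
    (∃ f₂ ∈ L1 μ, ∃ g₂ ∈ L1 ν, ∀ x y, c (x, y) ≤ f₂ x + g₂ y)}

/-- The values `P(c)`, `P ∈ Γ(μ, ν)`. -/
def primalValues (μ : Measure X) (ν : Measure Y) (c : X × Y → ℝ) : Set ℝ :=
  {r | ∃ P ∈ couplings μ ν, r = ∫ z, c z ∂P}

/-- The values `μ(f) + ν(g)` with `f ∈ L₁(μ)`, `g ∈ L₁(ν)` and `f + g ≤ c` everywhere. -/
def lowerDualValues (μ : Measure X) (ν : Measure Y) (c : X × Y → ℝ) : Set ℝ :=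
  {r | ∃ f ∈ L1 μ, ∃ g ∈ L1 ν, (∀ x y, f x + g y ≤ c (x, y)) ∧
    r = ∫ x, f x ∂μ + ∫ y, g y ∂ν}

/-- The values `μ(f) + ν(g)` with `f ∈ L₁(μ)`, `g ∈ L₁(ν)` and `f + g ≥ c` everywhere. -/
def upperDualValues (μ : Measure X) (ν : Measure Y) (c : X × Y → ℝ) : Set ℝ :=
  {r | ∃ f ∈ L1 μ, ∃ g ∈ L1 ν, (∀ x y, c (x, y) ≤ f x + g y) ∧
    r = ∫ x, f x ∂μ + ∫ y, g y ∂ν}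

/-- `α(c)`. For `c ∈ M` the infimum is over a nonempty bounded set and all the integrals exist,
see the facts below; the same applies to the next three definitions. -/
def alpha (μ : Measure X) (ν : Measure Y) (c : X × Y → ℝ) : ℝ := sInf (primalValues μ ν c)

/-- `α*(c)`. -/
def alphaStar (μ : Measure X) (ν : Measure Y) (c : X × Y → ℝ) : ℝ := sSup (primalValues μ ν c)

/-- `β(c)`. -/
def beta (μ : Measure X) (ν : Measure Y) (c : X × Y → ℝ) : ℝ := sSup (lowerDualValues μ ν c)

/-- `β*(c)`. -/
def betaStar (μ : Measure X) (ν : Measure Y) (c : X × Y → ℝ) : ℝ := sInf (upperDualValues μ ν c)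

/-- `A 0, A 1, …` is a countable measurable partition whose member `A 0` is null. Members may be
empty, so that finite partitions and `A 0 = ∅` are included. -/
structure IsNullFirstPartition {Ω : Type*} [MeasurableSpace Ω] (Q : Measure Ω)
    (A : ℕ → Set Ω) : Prop where
  measurableSet : ∀ i, MeasurableSet (A i)
  disjoint : ∀ i j, i ≠ j → Disjoint (A i) (A j)
  iUnion_eq : ⋃ i, A i = Set.univ
  null : Q (A 0) = 0

/-- Condition (∗). That a supremum over `y` is at most `ε` is written as a bound for all `y`. -/
def ConditionX (μ : Measure X) (c : X × Y → ℝ) : Prop :=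
  ∀ ε : ℝ, 0 < ε → ∃ A : ℕ → Set X, IsNullFirstPartition μ A ∧
    ∀ i, 0 < i → ∀ x ∈ A i, ∀ z ∈ A i, ∀ y : Y, |c (x, y) - c (z, y)| ≤ ε

/-- Condition (∗∗), the analogue of (∗) on `Y`. -/
def ConditionY (ν : Measure Y) (c : X × Y → ℝ) : Prop :=
  ∀ ε : ℝ, 0 < ε → ∃ B : ℕ → Set Y, IsNullFirstPartition ν B ∧
    ∀ i, 0 < i → ∀ y ∈ B i, ∀ z ∈ B i, ∀ x : X, |c (x, y) - c (x, z)| ≤ ε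

/-! Well-definedness of the four values on `M`. -/

theorem map_fst_of_mem {μ : Measure X} {ν : Measure Y} {P : Measure (X × Y)}
    (hP : P ∈ couplings μ ν) : P.map Prod.fst = μ := by
  ext A hA
  rw [Measure.map_apply measurable_fst hA, ← Set.prod_univ, hP.2.1 A hA]

theorem map_snd_of_mem {μ : Measure X} {ν : Measure Y} {P : Measure (X × Y)}
    (hP : P ∈ couplings μ ν) : P.map Prod.snd = ν := by
  ext B hB
  rw [Measure.map_apply measurable_snd hB, ← Set.univ_prod, hP.2.2 B hB]

theorem integral_add_of_mem {μ : Measure X} {ν : Measure Y} {P : Measure (X × Y)}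
    (hP : P ∈ couplings μ ν) {f : X → ℝ} {g : Y → ℝ} (hf : f ∈ L1 μ) (hg : g ∈ L1 ν) :
    Integrable (fun z : X × Y => f z.1 + g z.2) P ∧
      ∫ z, (f z.1 + g z.2) ∂P = ∫ x, f x ∂μ + ∫ y, g y ∂ν := by
  have h1 : Integrable (fun z : X × Y => f z.1) P := by
    have h := hf.2
    rw [← map_fst_of_mem hP] at h
    exact h.comp_measurable measurable_fst
  have h2 : Integrable (fun z : X × Y => g z.2) P := by
    have h := hg.2
    rw [← map_snd_of_mem hP] at h
    exact h.comp_measurable measurable_snd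
  refine ⟨h1.add h2, ?_⟩
  rw [integral_add h1 h2]
  congr 1
  · conv_rhs => rw [← map_fst_of_mem hP]
    rw [integral_map measurable_fst.aemeasurable hf.1.aestronglyMeasurable]
  · conv_rhs => rw [← map_snd_of_mem hP]
    rw [integral_map measurable_snd.aemeasurable hg.1.aestronglyMeasurable]

theorem integrable_of_mem {μ : Measure X} {ν : Measure Y} {P : Measure (X × Y)}
    (hP : P ∈ couplings μ ν) {c : X × Y → ℝ} (hc : c ∈ costs μ ν) : Integrable c P := by
  obtain ⟨hm, ⟨f₁, hf₁, g₁, hg₁, h₁⟩, ⟨f₂, hf₂, g₂, hg₂, h₂⟩⟩ := hc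
  exact integrable_of_le_of_le hm.aestronglyMeasurable
    (Filter.Eventually.of_forall fun z => h₁ z.1 z.2)
    (Filter.Eventually.of_forall fun z => h₂ z.1 z.2)
    (integral_add_of_mem hP hf₁ hg₁).1 (integral_add_of_mem hP hf₂ hg₂).1

theorem prod_mem_couplings (μ : Measure X) (ν : Measure Y) [IsProbabilityMeasure μ]
    [IsProbabilityMeasure ν] : μ.prod ν ∈ couplings μ ν := by
  refine ⟨inferInstance, fun A _ => ?_, fun B _ => ?_⟩ <;> simp

theorem lowerDual_le_primal {μ : Measure X} {ν : Measure Y} {c : X × Y → ℝ}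
    (hc : c ∈ costs μ ν) {r s : ℝ} (hr : r ∈ lowerDualValues μ ν c)
    (hs : s ∈ primalValues μ ν c) : r ≤ s := by
  obtain ⟨f, hf, g, hg, h, rfl⟩ := hr
  obtain ⟨P, hP, rfl⟩ := hs
  rw [← (integral_add_of_mem hP hf hg).2]
  exact integral_mono (integral_add_of_mem hP hf hg).1 (integrable_of_mem hP hc)
    fun z => h z.1 z.2

theorem primal_le_upperDual {μ : Measure X} {ν : Measure Y} {c : X × Y → ℝ}
    (hc : c ∈ costs μ ν) {r s : ℝ} (hr : r ∈ primalValues μ ν c)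
    (hs : s ∈ upperDualValues μ ν c) : r ≤ s := by
  obtain ⟨P, hP, rfl⟩ := hr
  obtain ⟨f, hf, g, hg, h, rfl⟩ := hs
  rw [← (integral_add_of_mem hP hf hg).2]
  exact integral_mono (integrable_of_mem hP hc) (integral_add_of_mem hP hf hg).1
    fun z => h z.1 z.2

theorem values_nonempty {μ : Measure X} {ν : Measure Y} [IsProbabilityMeasure μ]
    [IsProbabilityMeasure ν] {c : X × Y → ℝ} (hc : c ∈ costs μ ν) :
    (primalValues μ ν c).Nonempty ∧ (lowerDualValues μ ν c).Nonempty ∧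
      (upperDualValues μ ν c).Nonempty := by
  obtain ⟨-, ⟨f₁, hf₁, g₁, hg₁, h₁⟩, ⟨f₂, hf₂, g₂, hg₂, h₂⟩⟩ := hc
  exact ⟨⟨_, _, prod_mem_couplings μ ν, rfl⟩, ⟨_, f₁, hf₁, g₁, hg₁, h₁, rfl⟩,
    ⟨_, f₂, hf₂, g₂, hg₂, h₂, rfl⟩⟩

theorem values_bounded {μ : Measure X} {ν : Measure Y} [IsProbabilityMeasure μ]
    [IsProbabilityMeasure ν] {c : X × Y → ℝ} (hc : c ∈ costs μ ν) :
    BddBelow (primalValues μ ν c) ∧ BddAbove (primalValues μ ν c) ∧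
      BddAbove (lowerDualValues μ ν c) ∧ BddBelow (upperDualValues μ ν c) := by
  obtain ⟨⟨p, hp⟩, ⟨l, hl⟩, ⟨u, hu⟩⟩ := values_nonempty hc
  exact ⟨⟨l, fun _ h => lowerDual_le_primal hc hl h⟩, ⟨u, fun _ h => primal_le_upperDual hc h hu⟩,
    ⟨p, fun _ h => lowerDual_le_primal hc h hp⟩, ⟨p, fun _ h => primal_le_upperDual hc hp h⟩⟩

end MassTransport

end

/-! Weak duality is integration against a coupling. For the converse, exchanging the factors reduces
(∗∗) to (∗), and replacing `c` by `-c` reduces the starred equality to the other one. It remains to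
find, for each `ε`, a coupling and a dual pair whose values differ by at most `ε`.

Under (∗) all but a small part of `X` splits into finitely many cells on which `c (x, ·)` is
uniformly almost constant in `x`. With one representative per cell, and the bounds `f₁ + g₁` and `f₂
+ g₂` on the small remainder, the problem becomes transport between a finite weight and `ν`.

That problem (`exists_semidiscrete_duality`) is solved by entropic regularisation: the regularised
dual is a log-sum-exp functional on a finite-dimensional space. It attains its minimum, its
first-order condition says that the softmax weights have the right masses, and its duality gap
vanishes with the temperature. No topology on `Y` is needed.

The weights lift to a coupling of `μ` and `ν`, a finite sum of products
(`exists_coupling_of_weights`), and the dual pair is pulled back along the cell map.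
`exists_primal_le_lowerDual_add` collects the errors. -/

noncomputable section

namespace MassTransport

/-! ### Log-sum-exp. -/

section LogSumExp

variable {ι : Type*} [Fintype ι]

/-- The log-sum-exp function on `ι → ℝ`. -/
def logSumExp (v : ι → ℝ) : ℝ := Real.log (∑ i, Real.exp (v i))

theorem sum_exp_pos [Nonempty ι] (v : ι → ℝ) : 0 < ∑ i, Real.exp (v i) :=
  Finset.sum_pos (fun _ _ => Real.exp_pos _) Finset.univ_nonempty

theorem exp_logSumExp [Nonempty ι] (v : ι → ℝ) :
    Real.exp (logSumExp v) = ∑ i, Real.exp (v i) :=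
  Real.exp_log (sum_exp_pos v)

theorem le_logSumExp [Nonempty ι] (v : ι → ℝ) (i : ι) : v i ≤ logSumExp v := by
  rw [logSumExp, Real.le_log_iff_exp_le (sum_exp_pos v)]
  exact Finset.single_le_sum (f := fun i => Real.exp (v i)) (fun _ _ => (Real.exp_pos _).le)
    (Finset.mem_univ i)

theorem logSumExp_add_const [Nonempty ι] (v : ι → ℝ) (t : ℝ) :
    logSumExp (fun i => v i + t) = logSumExp v + t := by
  apply Real.exp_injective
  rw [Real.exp_add, exp_logSumExp, exp_logSumExp, Finset.sum_mul]
  simp only [Real.exp_add]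

theorem logSumExp_mono [Nonempty ι] {v w : ι → ℝ} (h : ∀ i, v i ≤ w i) :
    logSumExp v ≤ logSumExp w :=
  Real.log_le_log (sum_exp_pos v) (Finset.sum_le_sum fun i _ => Real.exp_le_exp.2 (h i))

/-- Monotonicity together with commutation with constants makes log-sum-exp nonexpansive in the sup
norm. -/
theorem abs_logSumExp_sub_le [Nonempty ι] {v w : ι → ℝ} {d : ℝ} (h : ∀ i, |v i - w i| ≤ d) :
    |logSumExp v - logSumExp w| ≤ d := by
  have h1 := logSumExp_mono (v := v) (w := fun i => w i + d)
    fun i => by linarith [(abs_le.1 (h i)).2]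
  have h2 := logSumExp_mono (v := w) (w := fun i => v i + d)
    fun i => by linarith [(abs_le.1 (h i)).1]
  rw [logSumExp_add_const] at h1 h2
  exact abs_le.2 ⟨by linarith, by linarith⟩

theorem abs_logSumExp_le [Nonempty ι] (v : ι → ℝ) :
    |logSumExp v| ≤ ∑ i, |v i| + |logSumExp (0 : ι → ℝ)| := by
  have h := abs_logSumExp_sub_le (v := v) (w := (0 : ι → ℝ)) (d := ∑ i, |v i|) fun i => by
    simpa using Finset.single_le_sum (s := Finset.univ) (f := fun i => |v i|)
      (fun _ _ => abs_nonneg _) (Finset.mem_univ i)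
  have := abs_sub_abs_le_abs_sub (logSumExp v) (logSumExp (0 : ι → ℝ))
  linarith

/-- Perturbing one coordinate of `logSumExp`, to first order. -/
theorem logSumExp_single_le [Nonempty ι] [DecidableEq ι] (v : ι → ℝ) (j : ι) (t : ℝ) :
    logSumExp (fun i => v i + if i = j then t else 0) ≤
      logSumExp v + (Real.exp t - 1) * Real.exp (v j - logSumExp v) := by
  have hs := sum_exp_pos v
  have hq : Real.exp (v j - logSumExp v) = Real.exp (v j) / ∑ i, Real.exp (v i) := by
    rw [Real.exp_sub, exp_logSumExp]
  have hsum : ∑ i, Real.exp (v i + if i = j then t else 0) =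
      ∑ i, Real.exp (v i) + (Real.exp t - 1) * Real.exp (v j) := by
    rw [← sub_eq_iff_eq_add', ← Finset.sum_sub_distrib, Finset.sum_eq_single j]
    · simp [Real.exp_add]; ring
    · intro i _ hi; simp [hi]
    · simp
  have hpos := sum_exp_pos fun i => v i + if i = j then t else 0
  have hlog := Real.log_le_sub_one_of_pos (div_pos hpos hs)
  rw [Real.log_div hpos.ne' hs.ne'] at hlog
  have he : (∑ i, Real.exp (v i + if i = j then t else 0)) / (∑ i, Real.exp (v i)) - 1 =
      (Real.exp t - 1) * Real.exp (v j - logSumExp v) := by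
    rw [hsum, hq]; field_simp; ring
  rw [he] at hlog
  simp only [logSumExp] at hlog ⊢
  linarith

end LogSumExp

/-! ### The entropic dual problem and its optimality condition. -/

section EntropicDuality

variable {ι : Type*} [Fintype ι] {Y : Type*} [MeasurableSpace Y]

theorem measurable_logSumExp_comp {C : ι → Y → ℝ} (hC : ∀ i, Measurable (C i)) (a : ι → ℝ) :
    Measurable fun y => logSumExp fun i => a i - C i y := by
  unfold logSumExp
  fun_prop

variable [Nonempty ι]

theorem integrable_logSumExp_comp {ν : Measure Y} [IsFiniteMeasure ν] {C : ι → Y → ℝ}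
    (hC : ∀ i, C i ∈ L1 ν) (a : ι → ℝ) :
    Integrable (fun y => logSumExp fun i => a i - C i y) ν := by
  have hb : Integrable (fun y => ∑ i, |a i - C i y| + |logSumExp (0 : ι → ℝ)|) ν :=
    (integrable_finsetSum _ fun i _ => ((integrable_const (a i)).sub (hC i).2).abs).add
      (integrable_const _)
  refine hb.mono' (measurable_logSumExp_comp (fun i => (hC i).1) a).aestronglyMeasurable ?_
  exact Filter.Eventually.of_forall fun y => abs_logSumExp_le _

/-- The negative of the entropic dual functional. -/
def entropicDual {ι Y : Type*} [Fintype ι] [MeasurableSpace Y] (ν : Measure Y) (C : ι → Y → ℝ) (p a : ι → ℝ) : ℝ :=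
  ∫ y, logSumExp (fun i => a i - C i y) ∂ν - ∑ i, p i * a i

theorem continuous_entropicDual {ν : Measure Y} [IsProbabilityMeasure ν] {C : ι → Y → ℝ}
    (hC : ∀ i, C i ∈ L1 ν) (p : ι → ℝ) : Continuous (entropicDual ν C p) := by
  refine Continuous.sub ?_ (by fun_prop)
  have : LipschitzWith 1 fun a : ι → ℝ => ∫ y, logSumExp (fun i => a i - C i y) ∂ν := by
    refine LipschitzWith.of_dist_le_mul fun a b => ?_
    rw [Real.dist_eq, ← integral_sub (integrable_logSumExp_comp hC a)
      (integrable_logSumExp_comp hC b)]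
    have h := norm_integral_le_of_norm_le_const (μ := ν) (C := dist a b)
      (f := fun y => logSumExp (fun i => a i - C i y) - logSumExp (fun i => b i - C i y))
      (Filter.Eventually.of_forall fun y => abs_logSumExp_sub_le fun i => by
        rw [sub_sub_sub_cancel_right, ← Real.dist_eq]
        exact dist_le_pi_dist a b i)
    simpa using h
  exact this.continuous

theorem entropicDual_add_const {ν : Measure Y} [IsProbabilityMeasure ν] {C : ι → Y → ℝ}
    (hC : ∀ i, C i ∈ L1 ν) {p : ι → ℝ} (hp : ∑ i, p i = 1) (a : ι → ℝ) (t : ℝ) :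
    entropicDual ν C p (fun i => a i + t) = entropicDual ν C p a := by
  have h : (fun y => logSumExp fun i => a i + t - C i y) =
      fun y => logSumExp (fun i => a i - C i y) + t := by
    funext y
    rw [← logSumExp_add_const]
    congr 1
    funext i
    ring
  rw [entropicDual, h, integral_add (integrable_logSumExp_comp hC a) (integrable_const t)]
  simp only [mul_add, Finset.sum_add_distrib, ← Finset.sum_mul, hp, entropicDual]
  simp

/-- Invariance under constants allows the normalisation `∑ i, p i * a i = 0`. Then a value not above
the one at `0` bounds every `a j` above, as log-sum-exp dominates each coordinate, and hence below,
as the weighted mean is zero and all weights are positive. Such points lie in a compact box. -/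
theorem exists_entropicDual_min {ν : Measure Y} [IsProbabilityMeasure ν] {C : ι → Y → ℝ}
    (hC : ∀ i, C i ∈ L1 ν) {p : ι → ℝ} (hp0 : ∀ i, 0 < p i) (hp : ∑ i, p i = 1) :
    ∃ a, ∀ b, entropicDual ν C p a ≤ entropicDual ν C p b := by
  classical
  set B : ℝ := |entropicDual ν C p 0| + ∑ i, |∫ y, C i y ∂ν| with hB
  have hB0 : 0 ≤ B := by positivity
  have hlow : ∀ a : ι → ℝ, ∑ i, p i * a i = 0 → entropicDual ν C p a ≤ entropicDual ν C p 0 →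
      ∀ j, a j ≤ B := by
    intro a ha hle j
    have h1 : ∫ y, (a j - C j y) ∂ν ≤ ∫ y, logSumExp (fun i => a i - C i y) ∂ν :=
      integral_mono ((integrable_const _).sub (hC j).2) (integrable_logSumExp_comp hC a)
        fun y => le_logSumExp (fun i => a i - C i y) j
    rw [integral_sub (integrable_const _) (hC j).2] at h1
    simp only [integral_const, probReal_univ, smul_eq_mul, one_mul] at h1
    have h2 : entropicDual ν C p a = ∫ y, logSumExp (fun i => a i - C i y) ∂ν := by
      rw [entropicDual, ha, sub_zero]
    have h3 := le_abs_self (entropicDual ν C p 0)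
    have h4 := le_abs_self (∫ y, C j y ∂ν)
    have h5 := Finset.single_le_sum (f := fun i => |∫ y, C i y ∂ν|) (fun _ _ => abs_nonneg _)
      (Finset.mem_univ j)
    linarith
  set K : Set (ι → ℝ) := Set.Icc (fun i => -(B / p i)) (fun _ => B) with hK
  obtain ⟨a, -, ha⟩ := (isCompact_Icc : IsCompact K).exists_isMinOn
    ⟨0, fun i => neg_nonpos.2 (div_nonneg hB0 (hp0 i).le), fun _ => hB0⟩
    (continuous_entropicDual hC p).continuousOn
  refine ⟨a, fun b => ?_⟩
  set b' : ι → ℝ := fun i => b i + -∑ i, p i * b i with hb'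
  rw [← entropicDual_add_const hC hp b (-∑ i, p i * b i)]
  have hsum : ∑ i, p i * b' i = 0 := by
    simp only [hb', mul_add, Finset.sum_add_distrib, ← Finset.sum_mul, hp]
    ring
  have h0 : entropicDual ν C p a ≤ entropicDual ν C p 0 :=
    ha ⟨fun i => neg_nonpos.2 (div_nonneg hB0 (hp0 i).le), fun _ => hB0⟩
  by_cases hle : entropicDual ν C p b' ≤ entropicDual ν C p 0
  · have hup := hlow b' hsum hle
    refine ha ⟨fun i => ?_, hup⟩
    rw [neg_le, le_div_iff₀ (hp0 i)]
    rw [← Finset.add_sum_erase _ _ (Finset.mem_univ i)] at hsum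
    have h1 : ∑ j ∈ Finset.univ.erase i, p j * b' j ≤ ∑ j ∈ Finset.univ.erase i, p j * B :=
      Finset.sum_le_sum fun j _ => mul_le_mul_of_nonneg_left (hup j) (hp0 j).le
    have h2 : ∑ j ∈ Finset.univ.erase i, p j * B ≤ ∑ j, p j * B :=
      Finset.sum_le_sum_of_subset_of_nonneg (Finset.erase_subset _ _)
        fun j _ _ => mul_nonneg (hp0 j).le hB0
    have h3 : ∑ j, p j * B = B := by rw [← Finset.sum_mul, hp, one_mul]
    change -b' i * p i ≤ B
    linarith
  · exact h0.trans (not_le.1 hle).le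

/-- The function vanishes at `t = 0`, which is thus a minimum, and its derivative there is `q - p`.
-/
theorem eq_of_forall_exp_sub_one_mul_le {p q : ℝ}
    (h : ∀ t : ℝ, 0 ≤ (Real.exp t - 1) * q - p * t) : q = p := by
  have hd : HasDerivAt (fun t : ℝ => (Real.exp t - 1) * q - p * t)
      (Real.exp 0 * q - p * 1) 0 :=
    (((Real.hasDerivAt_exp 0).sub_const 1).mul_const q).sub ((hasDerivAt_id 0).const_mul p)
  have hmin : IsLocalMin (fun t : ℝ => (Real.exp t - 1) * q - p * t) 0 :=
    Filter.Eventually.of_forall fun t => by simpa using h t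
  have := hmin.hasDerivAt_eq_zero hd
  simp only [Real.exp_zero] at this
  linarith

/-- Semi-discrete duality up to an additive entropic error. -/
theorem exists_entropic_duality {ν : Measure Y} [IsProbabilityMeasure ν] {C : ι → Y → ℝ}
    (hC : ∀ i, C i ∈ L1 ν) {p : ι → ℝ} (hp0 : ∀ i, 0 < p i) (hp : ∑ i, p i = 1) :
    ∃ h : ι → Y → ℝ, ∃ a : ι → ℝ, ∃ φ ∈ L1 ν, (∀ i, Measurable (h i)) ∧ (∀ i y, 0 ≤ h i y) ∧
      (∀ y, ∑ i, h i y = 1) ∧ (∀ i, ∫ y, h i y ∂ν = p i) ∧ (∀ i y, a i + φ y ≤ C i y) ∧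
      ∀ y, ∑ i, h i y * (C i y - a i) ≤ φ y + Fintype.card ι := by
  classical
  obtain ⟨a, ha⟩ := exists_entropicDual_min hC hp0 hp
  set ψ : Y → ℝ := fun y => logSumExp fun i => a i - C i y with hψ
  have hψm : Measurable ψ := measurable_logSumExp_comp (fun i => (hC i).1) a
  have hψi : Integrable ψ ν := integrable_logSumExp_comp hC a
  -- The softmax weights, which are the gradient of log-sum-exp at `a - C · y`.
  set h : ι → Y → ℝ := fun i y => Real.exp (a i - C i y - ψ y) with hh
  have hm : ∀ i, Measurable (h i) := fun i =>
    (((hC i).1.const_sub (a i)).sub hψm).exp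
  have hle : ∀ i y, a i - C i y ≤ ψ y := fun i y => le_logSumExp (fun i => a i - C i y) i
  have hint : ∀ i, Integrable (h i) ν := fun i =>
    (integrable_const (1 : ℝ)).mono' (hm i).aestronglyMeasurable
      (Filter.Eventually.of_forall fun y => by
        rw [Real.norm_eq_abs, abs_of_pos (Real.exp_pos _)]
        exact Real.exp_le_one_iff.2 (by linarith [hle i y]))
  have hsum : ∀ y, ∑ i, h i y = 1 := by
    intro y
    simp only [hh, Real.exp_sub _ (ψ y), ← Finset.sum_div]
    rw [hψ, exp_logSumExp]
    exact div_self (sum_exp_pos _).ne'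
  refine ⟨h, a, fun y => -ψ y, ⟨hψm.neg, hψi.neg⟩, hm, fun i y => (Real.exp_pos _).le, hsum,
    fun j => ?_, fun i y => by linarith [hle i y], fun y => ?_⟩
  -- First-order condition: the minimiser `a` is compared with its perturbation by `t` in coordinate
  -- `j`.
  · refine eq_of_forall_exp_sub_one_mul_le fun t => ?_
    have h1 := ha fun i => a i + if i = j then t else 0
    have h2 : ∫ y, logSumExp (fun i => (a i + if i = j then t else 0) - C i y) ∂ν ≤
        ∫ y, (ψ y + (Real.exp t - 1) * h j y) ∂ν := by
      refine integral_mono (integrable_logSumExp_comp hC _)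
        (hψi.add ((hint j).const_mul _)) fun y => ?_
      have := logSumExp_single_le (fun i => a i - C i y) j t
      simpa only [sub_add_eq_add_sub] using this
    rw [integral_add hψi ((hint j).const_mul _), integral_const_mul] at h2
    simp only [entropicDual, mul_add, Finset.sum_add_distrib, mul_ite, mul_zero,
      Finset.sum_ite_eq', Finset.mem_univ, if_true] at h1
    linarith
  -- Since `C i y - a i = -ψ y - log (h i y)`, this is the crude entropy bound `-h log h ≤ 1`. Its
  -- size is immaterial, because rescaling the cost will make the error small.
  · have h1 : ∀ i, h i y * (C i y - a i) ≤ h i y * -ψ y + 1 := by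
      intro i
      have h3 := Real.add_one_le_exp (-(a i - C i y - ψ y))
      have h4 : h i y * Real.exp (-(a i - C i y - ψ y)) = 1 := by
        rw [hh, ← Real.exp_add, add_neg_cancel, Real.exp_zero]
      have h5 : 0 < h i y := Real.exp_pos _
      nlinarith [mul_le_mul_of_nonneg_left h3 h5.le]
    calc ∑ i, h i y * (C i y - a i) ≤ ∑ i, (h i y * -ψ y + 1) :=
          Finset.sum_le_sum fun i _ => h1 i
      _ = _ := by
          rw [Finset.sum_add_distrib, ← Finset.sum_mul, hsum]
          simp

end EntropicDuality

theorem le_one_of_sum_eq_one {ι Y : Type*} [Fintype ι] {h : ι → Y → ℝ} (h0 : ∀ i y, 0 ≤ h i y)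
    (h1 : ∀ y, ∑ i, h i y = 1) (i : ι) (y : Y) : h i y ≤ 1 := by
  rw [← h1 y]
  exact Finset.single_le_sum (f := fun i => h i y) (fun i _ => h0 i y) (Finset.mem_univ i)

/-! ### Transport between a finite weight and `ν`. -/

section SemiDiscrete

variable {ι : Type*} [Fintype ι] {Y : Type*} [MeasurableSpace Y]

theorem L1.integrable_mul_of_le_one {ν : Measure Y} {G h : Y → ℝ} (hG : G ∈ L1 ν)
    (hm : Measurable h) (h0 : ∀ y, 0 ≤ h y) (h1 : ∀ y, h y ≤ 1) :
    Integrable (fun y => h y * G y) ν :=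
  hG.2.abs.mono' (hm.mul hG.1).aestronglyMeasurable (Filter.Eventually.of_forall fun y => by
    rw [Real.norm_eq_abs, abs_mul, abs_of_nonneg (h0 y)]
    exact mul_le_of_le_one_left (abs_nonneg _) (h1 y))

/-- Semi-discrete duality for positive weights. -/
theorem exists_semidiscrete_duality_of_pos [Nonempty ι] {ν : Measure Y} [IsProbabilityMeasure ν]
    {C : ι → Y → ℝ} (hC : ∀ i, C i ∈ L1 ν) {p : ι → ℝ} (hp0 : ∀ i, 0 < p i)
    (hp : ∑ i, p i = 1) {η : ℝ} (hη : 0 < η) :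
    ∃ h : ι → Y → ℝ, ∃ a : ι → ℝ, ∃ φ ∈ L1 ν, (∀ i, Measurable (h i)) ∧ (∀ i y, 0 ≤ h i y) ∧
      (∀ y, ∑ i, h i y = 1) ∧ (∀ i, ∫ y, h i y ∂ν = p i) ∧ (∀ i y, a i + φ y ≤ C i y) ∧
      ∑ i, ∫ y, h i y * C i y ∂ν ≤ ∑ i, p i * a i + ∫ y, φ y ∂ν + η := by
  have hn : (0 : ℝ) < Fintype.card ι := by exact_mod_cast Fintype.card_pos
  -- The temperature: solving for the cost `τ⁻¹ * C` and multiplying back by `τ` turns the error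
  -- `card ι` into `η`.
  set τ : ℝ := η / Fintype.card ι with hτ
  have hτ0 : 0 < τ := div_pos hη hn
  have hτn : τ * Fintype.card ι = η := div_mul_cancel₀ _ hn.ne'
  obtain ⟨h, a, φ, hφ, hm, h0, h1, hhp, hle, hopt⟩ :=
    exists_entropic_duality (C := fun i y => τ⁻¹ * C i y)
      (fun i => ⟨(hC i).1.const_mul _, (hC i).2.const_mul _⟩) hp0 hp
  have hle1 := le_one_of_sum_eq_one h0 h1
  have hhi : ∀ i, Integrable (h i) ν := fun i => by
    have h2 : (fun _ : Y => (1 : ℝ)) ∈ L1 ν := ⟨measurable_const, integrable_const _⟩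
    simpa using L1.integrable_mul_of_le_one h2 (hm i) (h0 i) (hle1 i)
  have hhC : ∀ i, Integrable (fun y => h i y * C i y) ν := fun i =>
    L1.integrable_mul_of_le_one (hC i) (hm i) (h0 i) (hle1 i)
  refine ⟨h, fun i => τ * a i, fun y => τ * φ y, ⟨hφ.1.const_mul _, hφ.2.const_mul _⟩, hm, h0, h1,
    hhp, fun i y => ?_, ?_⟩
  · rw [← mul_add]
    calc τ * (a i + φ y) ≤ τ * (τ⁻¹ * C i y) := mul_le_mul_of_nonneg_left (hle i y) hτ0.le
      _ = C i y := mul_inv_cancel_left₀ hτ0.ne' _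
  · have hpt : ∀ y, ∑ i, (h i y * C i y - h i y * (τ * a i)) ≤ τ * φ y + η := by
      intro y
      have := mul_le_mul_of_nonneg_left (hopt y) hτ0.le
      rw [Finset.mul_sum, mul_add, hτn] at this
      refine le_trans (Finset.sum_le_sum fun i _ => le_of_eq ?_) this
      field_simp
    have hint : ∫ y, ∑ i, (h i y * C i y - h i y * (τ * a i)) ∂ν ≤ ∫ y, (τ * φ y + η) ∂ν :=
      integral_mono
        (integrable_finsetSum _ fun i _ => (hhC i).sub ((hhi i).mul_const (τ * a i)))
        ((hφ.2.const_mul τ).add (integrable_const η)) hpt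
    have hterm : ∀ i, Integrable (fun y => h i y * C i y - h i y * (τ * a i)) ν := fun i =>
      (hhC i).sub ((hhi i).mul_const _)
    rw [integral_finsetSum _ fun i _ => hterm i, integral_add (hφ.2.const_mul τ) (integrable_const η)] at hint
    simp only [integral_const, probReal_univ, smul_eq_mul, one_mul] at hint
    have hs : ∀ i, ∫ y, (h i y * C i y - h i y * (τ * a i)) ∂ν =
        ∫ y, h i y * C i y ∂ν - p i * (τ * a i) := fun i => by
      rw [integral_sub (hhC i) ((hhi i).mul_const _), integral_mul_const, hhp]
    simp only [hs, Finset.sum_sub_distrib] at hint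
    linarith

/-- Dominated convergence with bound `|φ| + |m|`; at each point the minimum is eventually `φ`. -/
theorem tendsto_integral_min_add_nat {ν : Measure Y} {φ m : Y → ℝ} (hφ : φ ∈ L1 ν)
    (hm : m ∈ L1 ν) :
    Filter.Tendsto (fun n : ℕ => ∫ y, min (φ y) (m y + n) ∂ν) Filter.atTop
      (nhds (∫ y, φ y ∂ν)) := by
  refine tendsto_integral_of_dominated_convergence (fun y => |φ y| + |m y|)
    (fun n => (hφ.1.min (hm.1.add_const _)).aestronglyMeasurable) (hφ.2.abs.add hm.2.abs)
    (fun n => Filter.Eventually.of_forall fun y => ?_) (Filter.Eventually.of_forall fun y => ?_)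
  · have hn : (0 : ℝ) ≤ n := n.cast_nonneg
    rw [Real.norm_eq_abs, abs_le]
    refine ⟨le_min ?_ ?_, (min_le_left _ _).trans ?_⟩
    · linarith [neg_abs_le (φ y), abs_nonneg (m y)]
    · linarith [neg_abs_le (m y), abs_nonneg (φ y)]
    · linarith [le_abs_self (φ y), abs_nonneg (m y)]
  · refine tendsto_const_nhds.congr' ?_
    filter_upwards [Filter.eventually_ge_atTop ⌈φ y - m y⌉₊] with n hn
    have := Nat.ceil_le.1 hn
    rw [min_eq_left (by linarith)]

/-- Semi-discrete duality: an almost optimal coupling of a weight `p` on `ι` with `ν`, given by the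
conditional weights `h`, and an almost optimal dual pair `(a, φ)`. -/
theorem exists_semidiscrete_duality {ν : Measure Y} [IsProbabilityMeasure ν]
    {C : ι → Y → ℝ} (hC : ∀ i, C i ∈ L1 ν) {p : ι → ℝ} (hp0 : ∀ i, 0 ≤ p i)
    (hp : ∑ i, p i = 1) {η : ℝ} (hη : 0 < η) :
    ∃ h : ι → Y → ℝ, ∃ a : ι → ℝ, ∃ φ ∈ L1 ν, (∀ i, Measurable (h i)) ∧ (∀ i y, 0 ≤ h i y) ∧
      (∀ y, ∑ i, h i y = 1) ∧ (∀ i, ∫ y, h i y ∂ν = p i) ∧ (∀ i y, a i + φ y ≤ C i y) ∧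
      ∑ i, ∫ y, h i y * C i y ∂ν ≤ ∑ i, p i * a i + ∫ y, φ y ∂ν + η := by
  classical
  have hsub : ∀ F : ι → ℝ, (∀ i, ¬ 0 < p i → F i = 0) →
      ∑ i, F i = ∑ i : {i // 0 < p i}, F i := fun F hF => by
    rw [← Fintype.sum_subtype_add_sum_subtype (fun i => 0 < p i) F,
      Finset.sum_eq_zero (s := (Finset.univ : Finset {i // ¬ 0 < p i})) fun i _ => hF i i.2,
      add_zero]
  have hpz : ∀ i, ¬ 0 < p i → p i = 0 := fun i hi => le_antisymm (not_lt.1 hi) (hp0 i)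
  have hp' : ∑ i : {i // 0 < p i}, p i = 1 := by rw [← hsub p hpz, hp]
  have : Nonempty {i // 0 < p i} := by
    by_contra hne
    rw [not_nonempty_iff] at hne
    simp at hp'
  obtain ⟨h, a, φ, hφ, hm, h0, h1, hhp, hle, hopt⟩ :=
    exists_semidiscrete_duality_of_pos (ν := ν) (C := fun i : {i // 0 < p i} => C i)
      (fun i => hC i) (fun i => i.2) hp' (half_pos hη)
  -- Indices of weight zero get `h = 0` and the potential `-n`. Capping `φ` at `m + n` keeps them
  -- feasible, because `-n + (m + n) = m ≤ C i`, and for large `n` it lowers the integral by less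
  -- than `η / 2`.
  set m : Y → ℝ := fun y => -∑ i, |C i y| with hmdef
  have hmL : m ∈ L1 ν :=
    ⟨(Finset.measurable_sum _ fun i _ => (hC i).1.abs).neg,
      (integrable_finsetSum _ fun i _ => (hC i).2.abs).neg⟩
  obtain ⟨n, hn⟩ := ((tendsto_integral_min_add_nat hφ hmL).eventually
    (lt_mem_nhds (sub_lt_self _ (half_pos hη)))).exists
  set h' : ι → Y → ℝ := fun i y => if hi : 0 < p i then h ⟨i, hi⟩ y else 0 with hh'
  set a' : ι → ℝ := fun i => if hi : 0 < p i then a ⟨i, hi⟩ else -n with ha'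
  have e1 : ∀ i : {i // 0 < p i}, h' i = h i := fun i => by
    funext y; simp [hh', i.2]
  have e2 : ∀ i, ¬ 0 < p i → h' i = 0 := fun i hi => by
    funext y; simp [hh', hi]
  have e3 : ∀ i : {i // 0 < p i}, a' i = a i := fun i => by simp [ha', i.2]
  refine ⟨h', a', fun y => min (φ y) (m y + n), ⟨hφ.1.min (hmL.1.add_const _),
    hφ.2.inf (hmL.2.add (integrable_const _))⟩, fun i => ?_, fun i y => ?_, fun y => ?_,
    fun i => ?_, fun i y => ?_, ?_⟩
  · by_cases hi : 0 < p i
    · rw [e1 ⟨i, hi⟩]; exact hm _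
    · rw [e2 i hi]; exact measurable_zero
  · by_cases hi : 0 < p i
    · rw [e1 ⟨i, hi⟩]; exact h0 _ _
    · rw [e2 i hi]; rfl
  · rw [hsub _ fun i hi => by rw [e2 i hi]; rfl]
    simpa only [e1] using h1 y
  · by_cases hi : 0 < p i
    · rw [e1 ⟨i, hi⟩]; exact hhp _
    · rw [e2 i hi, hpz i hi]; simp
  · by_cases hi : 0 < p i
    · rw [e3 ⟨i, hi⟩]
      exact (add_le_add_right (min_le_left _ _) _).trans (hle ⟨i, hi⟩ y)
    · have h2 : a' i = -n := by simp [ha', hi]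
      have h3 := Finset.single_le_sum (f := fun i => |C i y|) (fun _ _ => abs_nonneg _)
        (Finset.mem_univ i)
      have h4 := min_le_right (φ y) (m y + n)
      have h5 : m y = -∑ i, |C i y| := rfl
      have h6 := neg_abs_le (C i y)
      rw [h2]
      linarith
  · rw [hsub (fun i => ∫ y, h' i y * C i y ∂ν) fun i hi => by simp [e2 i hi],
      hsub (fun i => p i * a' i) fun i hi => by simp [hpz i hi]]
    simp only [e1, e3]
    linarith

/-- Uniform integrability of a single integrable function, tested against weights. -/
theorem exists_pos_forall_integral_mul_le {ν : Measure Y} [IsFiniteMeasure ν] {G : Y → ℝ}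
    (hG : G ∈ L1 ν) {ε : ℝ} (hε : 0 < ε) :
    ∃ δ : ℝ, 0 < δ ∧ ∀ h : Y → ℝ, Measurable h → (∀ y, 0 ≤ h y) → (∀ y, h y ≤ 1) →
      ∫ y, h y ∂ν ≤ δ → ∫ y, h y * G y ∂ν ≤ ε := by
  have hz : (fun _ : Y => (0 : ℝ)) ∈ L1 ν := ⟨measurable_const, integrable_zero _ _ _⟩
  have hlim := tendsto_integral_min_add_nat (ν := ν) (φ := G) (m := fun _ => 0) hG hz
  obtain ⟨n, hn⟩ := (hlim.eventually (lt_mem_nhds (sub_lt_self _ (half_pos hε)))).exists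
  have hmin : Integrable (fun y => min (G y) (0 + n)) ν := hG.2.inf (integrable_const _)
  -- The denominator `n + 1` allows for `n = 0`.
  refine ⟨ε / 2 / (n + 1), by positivity, fun h hm h0 h1 hδ => ?_⟩
  have hone : (fun _ : Y => (1 : ℝ)) ∈ L1 ν := ⟨measurable_const, integrable_const _⟩
  have hhi : Integrable h ν := by
    simpa using L1.integrable_mul_of_le_one hone hm h0 h1
  -- Cut `G` at height `n`: the lower part is paid for by the mass of `h`, the excess by `h ≤ 1`.
  have hle : ∫ y, h y * G y ∂ν ≤ ∫ y, (h y * n + (G y - min (G y) (0 + n))) ∂ν := by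
    refine integral_mono (L1.integrable_mul_of_le_one hG hm h0 h1)
      ((hhi.mul_const _).add (hG.2.sub hmin)) fun y => ?_
    have h2 : h y * min (G y) (0 + n) ≤ h y * n :=
      mul_le_mul_of_nonneg_left ((min_le_right _ _).trans (zero_add _).le) (h0 y)
    have h3 := mul_le_mul_of_nonneg_right (h1 y) (sub_nonneg.2 (min_le_left (G y) (0 + n)))
    simp only
    linarith
  rw [integral_add (g := fun y => G y - min (G y) (0 + n)) (hhi.mul_const _) (hG.2.sub hmin),
    integral_sub hG.2 hmin,
    integral_mul_const] at hle
  have h4 : (∫ y, h y ∂ν) * n ≤ ε / 2 := by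
    have hn0 : (0 : ℝ) ≤ n := n.cast_nonneg
    calc (∫ y, h y ∂ν) * n ≤ ε / 2 / (n + 1) * n := mul_le_mul_of_nonneg_right hδ hn0
      _ ≤ ε / 2 / (n + 1) * (n + 1) := mul_le_mul_of_nonneg_left (by linarith) (by positivity)
      _ = ε / 2 := div_mul_cancel₀ _ (by positivity)
  linarith

end SemiDiscrete

/-! ### Couplings built from finitely many cells. -/

section Lifting

variable {X Y : Type*} [MeasurableSpace X] [MeasurableSpace Y]

/-- Conditional weights `h` on `Y` whose total masses are the masses of the cells `{k = i}` give a
coupling that is a mixture of product measures on these cells. -/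
theorem exists_coupling_of_weights {ι : Type*} [Fintype ι] [MeasurableSpace ι]
    [MeasurableSingletonClass ι] {μ : Measure X} {ν : Measure Y} [IsProbabilityMeasure μ]
    [IsProbabilityMeasure ν] {k : X → ι} (hk : Measurable k) {h : ι → Y → ℝ}
    (hm : ∀ i, Measurable (h i)) (h0 : ∀ i y, 0 ≤ h i y) (h1 : ∀ y, ∑ i, h i y = 1)
    (hp : ∀ i, ∫ y, h i y ∂ν = μ.real (k ⁻¹' {i})) :
    ∃ P ∈ couplings μ ν, ∀ w : ι → Y → ℝ, (∀ i, w i ∈ L1 ν) →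
      Integrable (fun z : X × Y => w (k z.1) z.2) P ∧
        ∫ z, w (k z.1) z.2 ∂P = ∑ i, ∫ y, h i y * w i y ∂ν := by
  classical
  have hle1 := le_one_of_sum_eq_one h0 h1
  have hone : (fun _ : Y => (1 : ℝ)) ∈ L1 ν := ⟨measurable_const, integrable_const _⟩
  have hhi : ∀ i, Integrable (h i) ν := fun i => by
    simpa using L1.integrable_mul_of_le_one hone (hm i) (h0 i) (hle1 i)
  have hmk : ∀ i, MeasurableSet (k ⁻¹' {i}) := fun i => hk (measurableSet_singleton i)
  set σ : ι → Measure X := fun i => ProbabilityTheory.cond μ (k ⁻¹' {i}) with hσ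
  set ρ : ι → Measure Y := fun i => ν.withDensity fun y => ENNReal.ofReal (h i y) with hρ
  have hρuniv : ∀ i, ρ i Set.univ = μ (k ⁻¹' {i}) := fun i => by
    rw [hρ, withDensity_apply _ MeasurableSet.univ, Measure.restrict_univ,
      ← ofReal_integral_eq_lintegral_ofReal (hhi i) (Filter.Eventually.of_forall (h0 i)), hp,
      ofReal_measureReal]
  have hρfin : ∀ i, IsFiniteMeasure (ρ i) := fun i =>
    ⟨by rw [hρuniv]; exact measure_lt_top _ _⟩
  -- On a null cell `σ i` is not a probability measure, but then `ρ i` vanishes and the product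
  -- contributes nothing.
  have hσzero : ∀ i, μ (k ⁻¹' {i}) = 0 → ρ i = 0 := fun i hi => by
    rw [← Measure.measure_univ_eq_zero, hρuniv, hi]
  have hσone : ∀ i, μ (k ⁻¹' {i}) ≠ 0 → IsProbabilityMeasure (σ i) := fun i hi =>
    ProbabilityTheory.cond_isProbabilityMeasure hi
  have hσk : ∀ i, ∀ᵐ x ∂σ i, k x = i := fun i =>
    ProbabilityTheory.ae_cond_mem (hmk i)
  set P : Measure (X × Y) := ∑ i, (σ i).prod (ρ i) with hP
  have happly : ∀ (A : Set X) (B : Set Y), P (A ×ˢ B) = ∑ i, σ i A * ρ i B := fun A B => by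
    rw [hP, Measure.finsetSum_apply]
    simp only [Measure.prod_prod]
  have hfst : ∀ A : Set X, MeasurableSet A → P (A ×ˢ Set.univ) = μ A := fun A hA => by
    rw [happly]
    calc ∑ i, σ i A * ρ i Set.univ = (∑ i, μ (k ⁻¹' {i}) • σ i) A := by
          rw [Measure.finsetSum_apply]
          refine Finset.sum_congr rfl fun i _ => ?_
          rw [hρuniv, Measure.smul_apply, smul_eq_mul, mul_comm]
      _ = μ A := by rw [hσ, ProbabilityTheory.sum_meas_smul_cond_fiber hk]
  refine ⟨P, ⟨⟨?_⟩, hfst, fun B hB => ?_⟩, fun w hw => ?_⟩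
  · rw [← Set.univ_prod_univ, hfst _ MeasurableSet.univ, measure_univ]
  · rw [happly]
    calc ∑ i, σ i Set.univ * ρ i B = ∑ i, ρ i B := by
          refine Finset.sum_congr rfl fun i _ => ?_
          by_cases hi : μ (k ⁻¹' {i}) = 0
          · simp [hσzero i hi]
          · have := hσone i hi
            rw [measure_univ, one_mul]
      _ = ∫⁻ y in B, ∑ i, ENNReal.ofReal (h i y) ∂ν := by
          rw [lintegral_finsetSum _ fun i _ => (hm i).ennreal_ofReal]
          exact Finset.sum_congr rfl fun i _ => withDensity_apply _ hB
      _ = ν B := by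
          simp only [← ENNReal.ofReal_sum_of_nonneg fun i _ => h0 i _, h1]
          simp
  · have hρint : ∀ i, Integrable (w i) (ρ i) ∧ ∫ y, w i y ∂ρ i = ∫ y, h i y * w i y ∂ν := by
      intro i
      have hlt : ∀ᵐ y ∂ν, ENNReal.ofReal (h i y) < ⊤ :=
        Filter.Eventually.of_forall fun y => ENNReal.ofReal_lt_top
      constructor
      · rw [hρ, integrable_withDensity_iff_integrable_smul' (hm i).ennreal_ofReal hlt]
        simp only [ENNReal.toReal_ofReal (h0 i _), smul_eq_mul]
        exact L1.integrable_mul_of_le_one (hw i) (hm i) (h0 i) (hle1 i)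
      · rw [hρ, integral_withDensity_eq_integral_toReal_smul (hm i).ennreal_ofReal hlt]
        simp only [ENNReal.toReal_ofReal (h0 i _), smul_eq_mul]
    -- `σ i` is concentrated on the cell where `k = i`.
    have hae : ∀ i, (fun z : X × Y => w i z.2) =ᵐ[(σ i).prod (ρ i)]
        fun z => w (k z.1) z.2 := fun i => by
      have := Measure.quasiMeasurePreserving_fst (μ := σ i) (ν := ρ i) |>.ae (hσk i)
      filter_upwards [this] with z hz
      rw [hz]
    have hcell : ∀ i, Integrable (fun z : X × Y => w (k z.1) z.2) ((σ i).prod (ρ i)) ∧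
        ∫ z, w (k z.1) z.2 ∂(σ i).prod (ρ i) = ∫ y, h i y * w i y ∂ν := by
      intro i
      rw [← integral_congr_ae (hae i), ← integrable_congr (hae i)]
      refine ⟨(hρint i).1.comp_snd (σ i), ?_⟩
      rw [integral_fun_snd, ← (hρint i).2]
      by_cases hi : μ (k ⁻¹' {i}) = 0
      · simp [hσzero i hi]
      · have := hσone i hi
        simp
    have hint : Integrable (fun z : X × Y => w (k z.1) z.2) P :=
      integrable_finsetSum_measure.2 fun i _ => (hcell i).1
    refine ⟨hint, ?_⟩
    rw [hP, integral_finsetSum_measure fun i _ => (hcell i).1]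
    exact Finset.sum_congr rfl fun i _ => (hcell i).2

/-! ### From the countable partition to finitely many cells, and the approximation argument. -/

theorem IsNullFirstPartition.exists_index {Q : Measure X} {A : ℕ → Set X}
    (hA : IsNullFirstPartition Q A) :
    ∃ idx : X → ℕ, Measurable idx ∧ (∀ x, x ∈ A (idx x)) ∧ ∀ᵐ x ∂Q, idx x ≠ 0 := by
  have hex : ∀ x, ∃ i, x ∈ A i := fun x => by
    have : x ∈ ⋃ i, A i := hA.iUnion_eq ▸ Set.mem_univ x
    exact Set.mem_iUnion.1 this
  choose idx hidx using hex
  have hpre : ∀ i, idx ⁻¹' {i} = A i := fun i => by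
    ext x
    refine ⟨fun hx => ?_, fun hx => ?_⟩
    · have : idx x = i := hx
      exact this ▸ hidx x
    · by_contra hne
      exact Set.disjoint_left.1 (hA.disjoint _ _ hne) (hidx x) hx
  refine ⟨idx, measurable_to_countable' fun i => hpre i ▸ hA.measurableSet i, hidx, ?_⟩
  rw [ae_iff]
  simp only [not_not]
  have := hpre 0
  rw [Set.preimage] at this
  simp only [Set.mem_singleton_iff] at this
  rw [this]
  exact hA.null

/-- Keeps the numbers up to `n` and sends the others to `0`. -/
def truncate (n m : ℕ) : Fin (n + 1) := if h : m < n + 1 then ⟨m, h⟩ else 0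

/-- The value `0` is excluded because the whole tail is sent there, next to the null member of the
partition. -/
theorem truncate_eq_iff {n m : ℕ} {i : Fin (n + 1)} (hi : i ≠ 0) :
    truncate n m = i ↔ m = i := by
  unfold truncate
  split_ifs with h
  · exact Fin.ext_iff
  · exact ⟨fun h' => absurd h'.symm hi, fun h' => absurd (h' ▸ i.2) h⟩

theorem truncate_ne_zero {n m : ℕ} (hm : m ≠ 0) (hn : m ≤ n) : truncate n m ≠ 0 := by
  rw [truncate, dif_pos (Nat.lt_succ_of_le hn)]
  exact fun h => hm (Fin.ext_iff.1 h)

/-- Almost every point has a nonzero index and so leaves the remainder cell for large `n`; `|F|`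
dominates. -/
theorem tendsto_integral_truncate {μ : Measure X} {idx : X → ℕ} (hidx : Measurable idx)
    (hne : ∀ᵐ x ∂μ, idx x ≠ 0) {F : X → ℝ} (hF : F ∈ L1 μ) :
    Filter.Tendsto (fun n : ℕ => ∫ x, (if truncate n (idx x) = 0 then F x else 0) ∂μ)
      Filter.atTop (nhds 0) := by
  have h := tendsto_integral_of_dominated_convergence (μ := μ) (f := fun _ => (0 : ℝ))
    (F := fun n x => if truncate n (idx x) = 0 then F x else 0) (fun x => |F x|)
    (fun n => (Measurable.ite (((Measurable.of_discrete (f := truncate n)).comp hidx) (measurableSet_singleton 0)) hF.1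
      measurable_const).aestronglyMeasurable) hF.2.abs
    (fun n => Filter.Eventually.of_forall fun x => by
      split_ifs <;> simp) (by
    filter_upwards [hne] with x hx
    refine tendsto_const_nhds.congr' ?_
    filter_upwards [Filter.eventually_ge_atTop (idx x)] with n hn
    rw [if_neg (truncate_ne_zero hx hn)])
  simpa using h

theorem integral_comp_finite {ι : Type*} [Fintype ι] [MeasurableSpace ι]
    [MeasurableSingletonClass ι] {μ : Measure X} [IsFiniteMeasure μ] {k : X → ι}
    (hk : Measurable k) (a : ι → ℝ) :
    Integrable (fun x => a (k x)) μ ∧ ∫ x, a (k x) ∂μ = ∑ i, μ.real (k ⁻¹' {i}) * a i := by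
  have hi : Integrable a (μ.map k) := Integrable.of_finite
  refine ⟨hi.comp_measurable hk, ?_⟩
  rw [← integral_map hk.aemeasurable hi.aestronglyMeasurable, integral_fintype hi]
  simp only [map_measureReal_apply hk (measurableSet_singleton _), smul_eq_mul]

/-- The bounds on `c` hold everywhere, so every section is integrable and any point of a cell can
represent it. -/
theorem section_mem_L1 {μ : Measure X} {ν : Measure Y} [IsFiniteMeasure ν] {c : X × Y → ℝ}
    (hc : c ∈ costs μ ν) (x : X) : (fun y => c (x, y)) ∈ L1 ν := by
  obtain ⟨hm, ⟨f₁, -, g₁, hg₁, h₁⟩, ⟨f₂, -, g₂, hg₂, h₂⟩⟩ := hc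
  have hmx : Measurable fun y => c (x, y) := hm.comp measurable_prodMk_left
  exact ⟨hmx, integrable_of_le_of_le hmx.aestronglyMeasurable
    (Filter.Eventually.of_forall (h₁ x)) (Filter.Eventually.of_forall (h₂ x))
    ((integrable_const _).add hg₁.2) ((integrable_const _).add hg₂.2)⟩

theorem L1.ite_eq {μ : Measure X} {ι : Type*} [MeasurableSpace ι] [MeasurableSingletonClass ι]
    [DecidableEq ι] {k : X → ι} (hk : Measurable k) (i : ι) {f g : X → ℝ} (hf : f ∈ L1 μ)
    (hg : g ∈ L1 μ) : (fun x => if k x = i then f x else g x) ∈ L1 μ := by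
  have hm : Measurable fun x => if k x = i then f x else g x :=
    Measurable.ite (hk (measurableSet_singleton i)) hf.1 hg.1
  refine ⟨hm, (hf.2.abs.add hg.2.abs).mono' hm.aestronglyMeasurable
    (Filter.Eventually.of_forall fun x => ?_)⟩
  simp only [Pi.add_apply, Real.norm_eq_abs]
  split_ifs
  · linarith [abs_nonneg (g x)]
  · linarith [abs_nonneg (f x)]

theorem const_mem_L1 (μ : Measure X) [IsFiniteMeasure μ] (t : ℝ) : (fun _ => t) ∈ L1 μ :=
  ⟨measurable_const, integrable_const t⟩

/-- Almost optimal primal and dual solutions. -/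
theorem exists_primal_le_lowerDual_add {μ : Measure X} {ν : Measure Y} [IsProbabilityMeasure μ]
    [IsProbabilityMeasure ν] {c : X × Y → ℝ} (hc : c ∈ costs μ ν) (hcond : ConditionX μ c)
    {ε : ℝ} (hε : 0 < ε) :
    ∃ r ∈ primalValues μ ν c, ∃ s ∈ lowerDualValues μ ν c, r ≤ s + ε := by
  classical
  have hsec := section_mem_L1 hc
  obtain ⟨-, ⟨f₁, hf₁, g₁, hg₁, hc₁⟩, ⟨f₂, hf₂, g₂, hg₂, hc₂⟩⟩ := id hc
  -- Five errors: two from the oscillation on cells, one each from `f₂ - f₁` and `g₂ - g₁` on the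
  -- remainder, one from semi-discrete duality.
  set e : ℝ := ε / 5 with he
  have he0 : 0 < e := by positivity
  obtain ⟨A, hA, hAc⟩ := hcond e he0
  obtain ⟨idx, hidxm, hidx, hne⟩ := hA.exists_index
  obtain ⟨δ, hδ, hui⟩ := exists_pos_forall_integral_mul_le (ν := ν) (G := fun y => g₂ y - g₁ y)
    ⟨hg₂.1.sub hg₁.1, hg₂.2.sub hg₁.2⟩ he0
  -- The integral of this function over the remainder cell controls both that of `f₂ - f₁` and,
  -- through the `1`, the mass of the cell.
  have hF : (fun x => |f₂ x - f₁ x| + 1) ∈ L1 μ :=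
    ⟨(hf₂.1.sub hf₁.1).abs.add_const _, (hf₂.2.sub hf₁.2).abs.add (integrable_const _)⟩
  obtain ⟨n, hn⟩ := ((tendsto_integral_truncate hidxm hne hF).eventually
    (gt_mem_nhds (lt_min hδ he0))).exists
  set k : X → Fin (n + 1) := fun x => truncate n (idx x) with hkdef
  have hk : Measurable k := (Measurable.of_discrete (f := truncate n)).comp hidxm
  -- the remainder cell is small
  have hRF := L1.ite_eq hk 0 hF (const_mem_L1 μ 0)
  have hmass : μ.real (k ⁻¹' {0}) ≤ δ := by
    have h1 := (integral_comp_finite (μ := μ) hk fun i => if i = 0 then 1 else 0)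
    simp only [mul_ite, mul_one, mul_zero, Finset.sum_ite_eq', Finset.mem_univ, if_true] at h1
    rw [← h1.2]
    refine (integral_mono h1.1 hRF.2 fun x => ?_).trans (hn.le.trans (min_le_left _ _))
    dsimp only
    split_ifs
    · linarith [abs_nonneg (f₂ x - f₁ x)]
    · exact le_rfl
  obtain ⟨x₀⟩ : Nonempty X := μ.nonempty_of_neZero
  -- An empty cell gets the arbitrary point `x₀`, for which the requirement is vacuous.
  have hrep : ∀ i : Fin (n + 1), ∃ z, ∀ x, k x = i → k z = i := fun i => by
    by_cases hi : ∃ z, k z = i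
    · exact ⟨hi.choose, fun _ _ => hi.choose_spec⟩
    · exact ⟨x₀, fun x hx => absurd ⟨x, hx⟩ hi⟩
  choose rep hrep using hrep
  have hnear : ∀ x, k x ≠ 0 → ∀ y, |c (x, y) - c (rep (k x), y)| ≤ e := by
    intro x hx y
    have h1 := (truncate_eq_iff hx).1 (rfl : truncate n (idx x) = k x)
    have h2 := (truncate_eq_iff hx).1 (hrep (k x) x rfl)
    have hpos : 0 < idx x := by
      rw [h1]
      exact Nat.pos_of_ne_zero fun h => hx (Fin.ext h)
    exact hAc (idx x) hpos x (hidx x) _ (by rw [h1, ← h2]; exact hidx _) y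
  -- `C` serves the minorant `u + C` of `c` and `W` the majorant `v + W`; they differ only at index
  -- `0`.
  set C : Fin (n + 1) → Y → ℝ := fun i => if i = 0 then g₁ else fun y => c (rep i, y) with hC
  set W : Fin (n + 1) → Y → ℝ := fun i => if i = 0 then g₂ else fun y => c (rep i, y) with hW
  have hCL : ∀ i, C i ∈ L1 ν := fun i => by
    simp only [hC]; split_ifs; exacts [hg₁, hsec _]
  have hWL : ∀ i, W i ∈ L1 ν := fun i => by
    simp only [hW]; split_ifs; exacts [hg₂, hsec _]
  have hu := L1.ite_eq hk 0 hf₁ (const_mem_L1 μ (-e))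
  have hv := L1.ite_eq hk 0 hf₂ (const_mem_L1 μ e)
  set u : X → ℝ := fun x => if k x = 0 then f₁ x else -e with hudef
  set v : X → ℝ := fun x => if k x = 0 then f₂ x else e with hvdef
  have huC : ∀ x y, u x + C (k x) y ≤ c (x, y) := fun x y => by
    by_cases hx : k x = 0
    · simpa [hudef, hC, hx] using hc₁ x y
    · simp only [hudef, hC, if_neg hx]
      linarith [(abs_le.1 (hnear x hx y)).1]
  have hvW : ∀ x y, c (x, y) ≤ v x + W (k x) y := fun x y => by
    by_cases hx : k x = 0
    · simpa [hvdef, hW, hx] using hc₂ x y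
    · simp only [hvdef, hW, if_neg hx]
      linarith [(abs_le.1 (hnear x hx y)).2]
  have hp := (integral_comp_finite (μ := μ) hk fun _ => 1).2
  simp only [integral_const, probReal_univ, smul_eq_mul, mul_one] at hp
  obtain ⟨h, a, φ, hφ, hm, h0, h1, hhp, hle, hopt⟩ :=
    exists_semidiscrete_duality hCL (fun i => measureReal_nonneg) hp.symm he0
  obtain ⟨P, hP, hPint⟩ := exists_coupling_of_weights hk hm h0 h1 hhp
  obtain ⟨hWi, hWe⟩ := hPint W hWL
  obtain ⟨hai, hae⟩ := integral_comp_finite (μ := μ) hk a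
  have haL : (fun x => u x + a (k x)) ∈ L1 μ :=
    ⟨hu.1.add (Measurable.of_discrete.comp hk), hu.2.add hai⟩
  refine ⟨_, ⟨P, hP, rfl⟩, _, ⟨_, haL, φ, hφ, fun x y => ?_, rfl⟩, ?_⟩
  · linarith [huC x y, hle (k x) y]
  obtain ⟨hvi, hve⟩ := integral_add_of_mem hP hv (const_mem_L1 ν 0)
  simp only [add_zero, integral_zero] at hvi hve
  have hub : ∫ z, c z ∂P ≤ ∫ x, v x ∂μ + ∑ i, ∫ y, h i y * W i y ∂ν := by
    rw [← hve, ← hWe, ← integral_add hvi hWi]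
    exact integral_mono (integrable_of_mem hP hc) (hvi.add hWi) fun z => hvW z.1 z.2
  -- Only index `0` contributes, and `h 0` has mass at most `δ`, so uniform integrability of `g₂ -
  -- g₁` applies.
  have hWC : ∑ i, ∫ y, h i y * W i y ∂ν ≤ ∑ i, ∫ y, h i y * C i y ∂ν + e := by
    rw [← sub_le_iff_le_add', ← Finset.sum_sub_distrib, Finset.sum_eq_single 0]
    · have hle1 := le_one_of_sum_eq_one h0 h1 0
      rw [← integral_sub (L1.integrable_mul_of_le_one (hWL 0) (hm 0) (h0 0) hle1)
        (L1.integrable_mul_of_le_one (hCL 0) (hm 0) (h0 0) hle1)]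
      simp only [← mul_sub]
      exact hui (h 0) (hm 0) (h0 0) hle1 ((hhp 0).trans_le hmass)
    · intro i _ hi
      simp [hW, hC, hi]
    · simp
  have hvu : ∫ x, v x ∂μ ≤ ∫ x, u x ∂μ + 3 * e := by
    have h2 : ∫ x, v x ∂μ ≤ ∫ x, (u x + 2 * e +
        if k x = 0 then |f₂ x - f₁ x| + 1 else 0) ∂μ := by
      refine integral_mono hv.2 ((hu.2.add (integrable_const _)).add hRF.2) fun x => ?_
      simp only [hudef, hvdef]
      split_ifs
      · linarith [le_abs_self (f₂ x - f₁ x)]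
      · linarith
    rw [integral_add (f := fun x => u x + 2 * e) (hu.2.add (integrable_const _)) hRF.2,
      integral_add hu.2 (integrable_const _)] at h2
    simp only [integral_const, probReal_univ, smul_eq_mul, one_mul] at h2
    have h3 := hn.le.trans (min_le_right _ _)
    linarith
  rw [integral_add hu.2 hai, hae]
  have : ε = 5 * e := by rw [he]; ring
  linarith

/-! ### Change of sign, exchange of the factors, and conclusion. -/

theorem neg_mem_L1 {μ : Measure X} {f : X → ℝ} (hf : f ∈ L1 μ) : (fun x => -f x) ∈ L1 μ :=
  ⟨hf.1.neg, hf.2.neg⟩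

theorem neg_mem_costs {μ : Measure X} {ν : Measure Y} {c : X × Y → ℝ} (hc : c ∈ costs μ ν) :
    (fun z => -c z) ∈ costs μ ν := by
  obtain ⟨hm, ⟨f₁, hf₁, g₁, hg₁, h₁⟩, ⟨f₂, hf₂, g₂, hg₂, h₂⟩⟩ := hc
  exact ⟨hm.neg, ⟨_, neg_mem_L1 hf₂, _, neg_mem_L1 hg₂, fun x y => by linarith [h₂ x y]⟩,
    ⟨_, neg_mem_L1 hf₁, _, neg_mem_L1 hg₁, fun x y => by linarith [h₁ x y]⟩⟩

theorem neg_mem_primalValues {μ : Measure X} {ν : Measure Y} {c : X × Y → ℝ} {r : ℝ}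
    (hr : r ∈ primalValues μ ν fun z => -c z) : -r ∈ primalValues μ ν c := by
  obtain ⟨P, hP, rfl⟩ := hr
  exact ⟨P, hP, by rw [integral_neg, neg_neg]⟩

theorem neg_mem_upperDualValues {μ : Measure X} {ν : Measure Y} {c : X × Y → ℝ} {s : ℝ}
    (hs : s ∈ lowerDualValues μ ν fun z => -c z) : -s ∈ upperDualValues μ ν c := by
  obtain ⟨f, hf, g, hg, h, rfl⟩ := hs
  exact ⟨_, neg_mem_L1 hf, _, neg_mem_L1 hg, fun x y => by linarith [h x y], by
    rw [integral_neg, integral_neg, neg_add]⟩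

theorem swap_mem_costs {μ : Measure X} {ν : Measure Y} {c : X × Y → ℝ} (hc : c ∈ costs μ ν) :
    (fun z => c z.swap) ∈ costs ν μ := by
  obtain ⟨hm, ⟨f₁, hf₁, g₁, hg₁, h₁⟩, ⟨f₂, hf₂, g₂, hg₂, h₂⟩⟩ := hc
  exact ⟨hm.comp measurable_swap, ⟨g₁, hg₁, f₁, hf₁, fun y x => (add_comm _ _).trans_le (h₁ x y)⟩,
    ⟨g₂, hg₂, f₂, hf₂, fun y x => (h₂ x y).trans_eq (add_comm _ _)⟩⟩

theorem map_swap_mem_couplings {μ : Measure X} {ν : Measure Y} {P : Measure (Y × X)}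
    (hP : P ∈ couplings ν μ) : P.map Prod.swap ∈ couplings μ ν := by
  obtain ⟨hprob, h₁, h₂⟩ := hP
  refine ⟨Measure.isProbabilityMeasure_map measurable_swap.aemeasurable, fun A hA => ?_,
    fun B hB => ?_⟩
  · rw [Measure.map_apply measurable_swap (hA.prod MeasurableSet.univ), Set.preimage_swap_prod,
      h₂ A hA]
  · rw [Measure.map_apply measurable_swap (MeasurableSet.univ.prod hB), Set.preimage_swap_prod,
      h₁ B hB]

theorem mem_primalValues_of_swap {μ : Measure X} {ν : Measure Y} {c : X × Y → ℝ}
    (hc : Measurable c) {r : ℝ} (hr : r ∈ primalValues ν μ fun z => c z.swap) :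
    r ∈ primalValues μ ν c := by
  obtain ⟨P, hP, rfl⟩ := hr
  exact ⟨_, map_swap_mem_couplings hP,
    (integral_map measurable_swap.aemeasurable hc.aestronglyMeasurable).symm⟩

theorem mem_lowerDualValues_of_swap {μ : Measure X} {ν : Measure Y} {c : X × Y → ℝ} {s : ℝ}
    (hs : s ∈ lowerDualValues ν μ fun z => c z.swap) : s ∈ lowerDualValues μ ν c := by
  obtain ⟨g, hg, f, hf, h, rfl⟩ := hs
  exact ⟨f, hf, g, hg, fun x y => (add_comm _ _).trans_le (h y x), add_comm _ _⟩

theorem alpha_eq_beta {μ : Measure X} {ν : Measure Y} [IsProbabilityMeasure μ]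
    [IsProbabilityMeasure ν] {c : X × Y → ℝ} (hc : c ∈ costs μ ν)
    (h : ConditionX μ c ∨ ConditionY ν c) : alpha μ ν c = beta μ ν c := by
  obtain ⟨hpne, hlne, -⟩ := values_nonempty hc
  obtain ⟨hpb, -, hlb, -⟩ := values_bounded hc
  refine le_antisymm (le_of_forall_pos_le_add fun ε hε => ?_)
    (csSup_le hlne fun s hs => le_csInf hpne fun r hr => lowerDual_le_primal hc hs hr)
  obtain ⟨r, hr, s, hs, hrs⟩ :
      ∃ r ∈ primalValues μ ν c, ∃ s ∈ lowerDualValues μ ν c, r ≤ s + ε := by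
    rcases h with h | h
    · exact exists_primal_le_lowerDual_add hc h hε
    · obtain ⟨r, hr, s, hs, hrs⟩ := exists_primal_le_lowerDual_add (swap_mem_costs hc) h hε
      exact ⟨r, mem_primalValues_of_swap hc.1 hr, s, mem_lowerDualValues_of_swap hs, hrs⟩
  exact (csInf_le hpb hr).trans (hrs.trans (by simpa [beta] using le_csSup hlb hs))

/-- The negation rules for `sInf` and for the integral hold for their default values too, so `c` can
be arbitrary. -/
theorem alpha_neg (μ : Measure X) (ν : Measure Y) (c : X × Y → ℝ) :
    alpha μ ν (fun z => -c z) = -alphaStar μ ν c := by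
  rw [alpha, alphaStar, ← Real.sInf_neg]
  congr 1
  ext r
  exact ⟨neg_mem_primalValues, fun hr => by
    simpa using neg_mem_primalValues (c := fun z => -c z) (r := -r) (by simpa using hr)⟩

theorem beta_neg (μ : Measure X) (ν : Measure Y) (c : X × Y → ℝ) :
    beta μ ν (fun z => -c z) = -betaStar μ ν c := by
  rw [beta, betaStar, ← Real.sSup_neg]
  congr 1
  ext s
  refine ⟨neg_mem_upperDualValues, fun hs => ?_⟩
  obtain ⟨f, hf, g, hg, h, hs⟩ := hs
  refine ⟨_, neg_mem_L1 hf, _, neg_mem_L1 hg, fun x y => by linarith [h x y], ?_⟩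
  rw [integral_neg, integral_neg, ← neg_add, ← hs, neg_neg]

end Lifting

end MassTransport

end

theorem theorem3p1 {X Y : Type*} [MeasurableSpace X] [MeasurableSpace Y]
    (μ : Measure X) (ν : Measure Y) [IsProbabilityMeasure μ] [IsProbabilityMeasure ν]
    (c : X × Y → ℝ) (hc : c ∈ MassTransport.costs μ ν)
    (h : MassTransport.ConditionX μ c ∨ MassTransport.ConditionY ν c) :
    MassTransport.alpha μ ν c = MassTransport.beta μ ν c ∧
      MassTransport.alphaStar μ ν c = MassTransport.betaStar μ ν c := by
  have habs : ∀ a b : ℝ, |-a - -b| = |a - b| := fun a b => by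
    rw [neg_sub_neg, abs_sub_comm]
  have hneg : MassTransport.ConditionX μ (fun z => -c z) ∨
      MassTransport.ConditionY ν (fun z => -c z) := by
    simpa only [MassTransport.ConditionX, MassTransport.ConditionY, habs] using h
  have h' := MassTransport.alpha_eq_beta (MassTransport.neg_mem_costs hc) hneg
  rw [MassTransport.alpha_neg, MassTransport.beta_neg, neg_inj] at h'
  exact ⟨MassTransport.alpha_eq_beta hc h, h'⟩
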